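/- \textbf{Theorem.} Let $N$ be a finite-dimensional smooth ($C^\infty$) manifold without boundary, Hausdorff and second countable, and let $u:N\to\mathbb R$ be locally Lipschitz (with respect to the distance of some, equivalently any, Riemannian metric; equivalently, locally Lipschitz in charts). For $y\in N$, let $$\partial^*u(y)=\{p\in T_y^*N:\ \text{there are points } x_n \text{ of differentiability of } u \text{ with } (x_n,d_{x_n}u)\to(y,p) \text{ in } T^*N\},$$ and let the Clarke generalized derivative $\partial^c u(y)$ be the closed convex hull of $\partial^*u(y)$ in $T^*_yN$. Let $U\subseteq N$ be open, let $T^*U=\{(x,p)\in T^*N: x\in U\}$, and let $H:T^*U\to\mathbb R$ be a continuous function such that $$H(x,p)<0\quad\text{for every } x\in U \text{ and every } p\in\partial^c u(x).$$ Then for every continuous function $\epsilon:U\to\,]0,+\infty[$ there is a continuous function $u_\epsilon:N\to\mathbb R$ such that \begin{enumerate} \item $u_\epsilon$ is $C^\infty$ on $U$, and $H(x,d_xu_\epsilon)<0$ for every $x\in U$; \item $|u(x)-u_\epsilon(x)|\le\epsilon(x)$ for every $x\in U$; \item $u_\epsilon=u$ on $N\setminus U$; moreover, at every point $x\in N\setminus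 U$, the function $u_\epsilon$ is differentiable if and only if $u$ is differentiable, and in that case $d_xu_\epsilon=d_xu$. \end{enumerate} -/

import Mathlib

open Set Filter Topology Bundle
open scoped Manifold ContDiff

/-- The cotangent space `T_x^* N` of a manifold `N` modelled on the real normed space `E`. -/
abbrev CotangentSpace (E : Type*) [NormedAddCommGroup E] [NormedSpace ℝ E]
    {N : Type*} [TopologicalSpace N] [ChartedSpace E N] (x : N) : Type _ :=
  TangentSpace 𝓘(ℝ, E) x →L[ℝ] Bundle.Trivial N ℝ x

/-- The cotangent bundle `T^* N`, with Mathlib's vector bundle topology. -/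
abbrev CotangentBundle (E : Type*) [NormedAddCommGroup E] [NormedSpace ℝ E]
    (N : Type*) [TopologicalSpace N] [ChartedSpace E N] : Type _ :=
  TotalSpace (E →L[ℝ] ℝ) (fun x : N => CotangentSpace E x)

/-- `u` is differentiable at the point `x` of the manifold `N`. -/
abbrev IsDiffAt (E : Type*) [NormedAddCommGroup E] [NormedSpace ℝ E]
    {N : Type*} [TopologicalSpace N] [ChartedSpace E N] (u : N → ℝ) (x : N) : Prop :=
  MDifferentiableAt 𝓘(ℝ, E) 𝓘(ℝ, ℝ) u x

/-- The differential `d_x u`, as an element of `T_x^* N` (every tangent space of `ℝ` is `ℝ`). -/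
noncomputable def differential (E : Type*) [NormedAddCommGroup E] [NormedSpace ℝ E]
    {N : Type*} [TopologicalSpace N] [ChartedSpace E N] (u : N → ℝ) (x : N) :
    CotangentSpace E x :=
  mvfderiv 𝓘(ℝ, E) u x

/-- `u` is locally Lipschitz on the manifold `N`: around every point, it is Lipschitz when read
in a chart. On a smooth manifold this does not depend on the chart, and it is the same as being
locally Lipschitz for the distance of any Riemannian metric. -/
def IsLocallyLipschitz (E : Type*) [NormedAddCommGroup E] [NormedSpace ℝ E]
    {N : Type*} [TopologicalSpace N] [ChartedSpace E N] (u : N → ℝ) : Prop :=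
  ∀ x : N, ∃ K : NNReal, ∃ s ∈ 𝓝 (chartAt E x x),
    LipschitzOnWith K (u ∘ (chartAt E x).symm) s

/-- The set `∂^* u(y)` of reachable derivatives of `u` at `y`: the limits in `T^* N`, over `y`, of
sequences `(x_n, d_{x_n} u)`, where `u` is differentiable at every `x_n`. -/
def reachableDerivatives (E : Type*) [NormedAddCommGroup E] [NormedSpace ℝ E]
    {N : Type*} [TopologicalSpace N] [ChartedSpace E N] [IsManifold 𝓘(ℝ, E) 1 N]
    (u : N → ℝ) (y : N) : Set (CotangentSpace E y) :=
  {p | ∃ x : ℕ → N, (∀ n, IsDiffAt E u (x n)) ∧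
    Tendsto (fun n => (⟨x n, differential E u (x n)⟩ : CotangentBundle E N)) atTop
      (𝓝 (⟨y, p⟩ : CotangentBundle E N))}

/-- The Clarke generalized derivative `∂^c u(y)`: the closed convex hull of `∂^* u(y)`
in `T_y^* N`. -/
def clarkeDerivative (E : Type*) [NormedAddCommGroup E] [NormedSpace ℝ E]
    {N : Type*} [TopologicalSpace N] [ChartedSpace E N] [IsManifold 𝓘(ℝ, E) 1 N]
    (u : N → ℝ) (y : N) : Set (CotangentSpace E y) :=
  closure (convexHull ℝ (reachableDerivatives E u y))

/-- The graph of the Clarke generalized derivative, a subset of `T^* N`. -/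
def clarkeGraph (E : Type*) [NormedAddCommGroup E] [NormedSpace ℝ E]
    {N : Type*} [TopologicalSpace N] [ChartedSpace E N] [IsManifold 𝓘(ℝ, E) 1 N]
    (u : N → ℝ) : Set (CotangentBundle E N) :=
  {z | z.2 ∈ clarkeDerivative E u z.1}

/-!
The function `u` is smoothed by mollification in charts, one chart after the other. What is carried
along is a form of the Clarke condition that does not mention points of differentiability: near each
point `x` of `U`, in a chart, every increment `u b - u a` equals `p (b - a)` for some `p` in a fixed
compact convex set `C` of linear forms (`HasSlopesIn`), and `H` is negative on the covectors
at `x` given by `C` (`IsAdmissibleAt`).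

This condition is implied by the hypothesis on the Clarke derivative. Derivatives at points of
differentiability near `x` lie in a thickening of the convex hull of their limits, by compactness.
By Rademacher's theorem, the derivatives of mollifications are then averages of elements of the
thickening; the mean value theorem for the mollifications, in the limit, gives the statement about
increments (`hasSlopesIn_of_fderiv_mem`, `isAdmissibleAt_of_clarke_neg`). Conversely, the
differential of an admissible function belongs to `C` wherever it exists, by Hahn-Banach separation
(`HasSlopesIn.fderiv_mem`).

The condition is stable under the operations needed. It passes to mollifications since `C` is
convex. It passes to an interpolation `f + G * (w - f)` between `f` and its mollification `w`, at
the cost of a thickening of `C` whose size is a bound for `w - f` times a Lipschitz constant of the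
cutoff `G` (`HasSlopesIn.eventually_mollify`). It is independent of the chart, by strict
differentiability of the transition maps. As `H` is continuous and `C` is compact, small
thickenings of `C`, at nearby points, are harmless (`exists_thickening_neg`). Hence one can smooth
`u` on a compact subset of a chart without losing smoothness obtained before
(`exists_smoothing_in_chart`), and do so along a locally finite sequence of cutoffs that exhausts
`U` (`exists_smooth_admissible`).

For the behaviour on the complement of `U`, the approximation error is kept below a smooth function
`f` that is positive exactly on `U`. At the zeros of `f` its differential vanishes, so the
perturbation is negligible to first order there (`differential_eq_of_abs_sub_le`).
-/

/-! ### Slopes of functions on a normed space -/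

section VectorSpace

open MeasureTheory Metric ContinuousLinearMap

variable {E : Type*} [NormedAddCommGroup E] [NormedSpace ℝ E]

/-- The slopes of `f` near `y` lie in the set `C` of linear forms: for all points `a` and `b` near
`y`, the increment `f b - f a` is the value at `b - a` of some element of `C`. For compact convex
`C` this says that the Clarke derivatives of `f` near `y` lie in `C`, but it does not mention
points of differentiability. -/
def HasSlopesIn (f : E → ℝ) (C : Set (E →L[ℝ] ℝ)) (y : E) : Prop :=
  ∀ᶠ q : E × E in 𝓝 (y, y), ∃ p ∈ C, f q.2 - f q.1 = p (q.2 - q.1)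

theorem hasSlopesIn_iff_ball {f : E → ℝ} {C : Set (E →L[ℝ] ℝ)} {y : E} :
    HasSlopesIn f C y ↔
      ∃ r > 0, ∀ a ∈ ball y r, ∀ b ∈ ball y r, ∃ p ∈ C, f b - f a = p (b - a) := by
  unfold HasSlopesIn
  rw [Metric.eventually_nhds_iff_ball]
  simp only [← ball_prod_same, Prod.forall, mem_prod]
  exact ⟨fun ⟨r, hr, h⟩ => ⟨r, hr, fun a ha b hb => h a b ⟨ha, hb⟩⟩,
    fun ⟨r, hr, h⟩ => ⟨r, hr, fun a b hab => h a hab.1 b hab.2⟩⟩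

theorem HasSlopesIn.congr {f g : E → ℝ} {C : Set (E →L[ℝ] ℝ)} {y : E} (h : HasSlopesIn f C y)
    (hfg : f =ᶠ[𝓝 y] g) : HasSlopesIn g C y := by
  unfold HasSlopesIn at *
  rw [nhds_prod_eq] at *
  filter_upwards [h, hfg.prod_mk hfg] with q hq hfgq
  rwa [← hfgq.1, ← hfgq.2]

theorem IsCompact.exists_norm_le_clm {C : Set (E →L[ℝ] ℝ)} (hC : IsCompact C) :
    ∃ R > 0, ∀ p ∈ C, ‖p‖ ≤ R := by
  obtain ⟨R, hR⟩ := hC.isBounded.exists_norm_le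
  exact ⟨max R 1, by positivity, fun p hp => (hR p hp).trans (le_max_left _ _)⟩

theorem HasSlopesIn.continuousAt {f : E → ℝ} {C : Set (E →L[ℝ] ℝ)} {y : E}
    (h : HasSlopesIn f C y) (hC : IsCompact C) : ContinuousAt f y := by
  obtain ⟨R, hR, hCR⟩ := hC.exists_norm_le_clm
  obtain ⟨r, hr, h⟩ := hasSlopesIn_iff_ball.1 h
  refine continuousAt_of_locally_lipschitz hr R fun a ha => ?_
  obtain ⟨p, hp, hpe⟩ := h y (mem_ball_self hr) a ha
  rw [Real.dist_eq, hpe, ← Real.norm_eq_abs, dist_eq_norm]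
  exact p.le_of_opNorm_le (hCR p hp) _

/-- The values at a vector `v` of a compact convex set of linear forms fill a compact interval. -/
theorem Convex.exists_clm_apply_eq_iff_mem_Icc {C : Set (E →L[ℝ] ℝ)} (hconv : Convex ℝ C)
    (hC : IsCompact C) (hne : C.Nonempty) (v : E) :
    ∃ m M : ℝ, ∀ t, (∃ p ∈ C, t = p v) ↔ t ∈ Icc m M := by
  have hcont : Continuous fun p : E →L[ℝ] ℝ => p v := (apply ℝ ℝ v).continuous
  have hI : IsConnected ((fun p : E →L[ℝ] ℝ => p v) '' C) :=
    ⟨hne.image _, hconv.isPreconnected.image _ hcont.continuousOn⟩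
  refine ⟨sInf ((fun p : E →L[ℝ] ℝ => p v) '' C), sSup ((fun p : E →L[ℝ] ℝ => p v) '' C),
    fun t => ?_⟩
  rw [← eq_Icc_of_connected_compact hI (hC.image hcont)]
  simp only [mem_image, eq_comm]

/-- An error of size at most `η * ‖v‖` in the value at `v` is absorbed by a thickening. -/
theorem exists_mem_cthickening_apply_eq {C : Set (E →L[ℝ] ℝ)} {p : E →L[ℝ] ℝ} (hp : p ∈ C)
    {v : E} {e η : ℝ} (he : |e| ≤ η * ‖v‖) (hη : 0 ≤ η) :
    ∃ q ∈ cthickening η C, p v + e = q v := by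
  by_cases hv : ‖v‖ = 0
  · have he0 : e = 0 := by simpa [hv] using he
    exact ⟨p, self_subset_cthickening _ hp, by simp [he0]⟩
  · obtain ⟨g, hg, hgv⟩ := exists_dual_vector ℝ v hv
    refine ⟨p + (e / ‖v‖) • g, mem_cthickening_of_dist_le _ p _ _ hp ?_, ?_⟩
    · rw [dist_eq_norm, add_sub_cancel_left, norm_smul, hg, mul_one, Real.norm_eq_abs, abs_div,
        abs_norm]
      exact div_le_of_le_mul₀ (norm_nonneg _) hη he
    · simp only [add_apply, smul_apply, hgv, smul_eq_mul, RCLike.ofReal_real_eq_id, id]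
      field_simp

/-- Changing coordinates by `τ` transforms slopes by the derivative of `τ`, up to a thickening. -/
theorem HasSlopesIn.comp_hasStrictFDerivAt {f : E → ℝ} {C : Set (E →L[ℝ] ℝ)} {τ : E → E}
    {A : E →L[ℝ] E} {y : E} (h : HasSlopesIn f C (τ y)) (hτ : HasStrictFDerivAt τ A y)
    (hC : IsCompact C) {η : ℝ} (hη : 0 < η) :
    HasSlopesIn (f ∘ τ) (cthickening η ((fun p => p ∘L A) '' C)) y := by
  obtain ⟨R, hR, hCR⟩ := hC.exists_norm_le_clm
  have hlim : Tendsto (fun q : E × E => (τ q.1, τ q.2)) (𝓝 (y, y)) (𝓝 (τ y, τ y)) := by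
    have hc := hτ.continuousAt
    exact ContinuousAt.prodMk (f := fun q : E × E => τ q.1) (g := fun q : E × E => τ q.2)
      (hc.comp_of_eq continuousAt_fst rfl) (hc.comp_of_eq continuousAt_snd rfl)
  have hsw : Tendsto (Prod.swap : E × E → E × E) (𝓝 (y, y)) (𝓝 (y, y)) :=
    continuous_swap.tendsto _
  have ho := hsw.eventually (hτ.isLittleO.def (div_pos hη hR))
  filter_upwards [hlim.eventually h, ho] with q hq hoq
  obtain ⟨p, hp, hpe⟩ := hq
  simp only [Prod.fst_swap, Prod.snd_swap] at hoq
  obtain ⟨p', hp', hpe'⟩ := exists_mem_cthickening_apply_eq (η := η)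
    (mem_image_of_mem (fun p : E →L[ℝ] ℝ => p ∘L A) hp) (v := q.2 - q.1)
    (e := p (τ q.2 - τ q.1 - A (q.2 - q.1))) (by
      rw [← Real.norm_eq_abs]
      calc _ ≤ R * (η / R * ‖q.2 - q.1‖) := p.le_of_opNorm_le_of_le (hCR p hp) hoq
        _ = _ := by field_simp) hη.le
  refine ⟨p', hp', ?_⟩
  rw [← hpe', Function.comp_apply, Function.comp_apply, hpe]
  simp

/-- A derivative at `y` belongs to `C`: otherwise it would be separated from `C` by evaluation at a
vector `v`, while its value at `v` is a limit of values at `v` of elements of `C`. -/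
theorem HasSlopesIn.fderiv_mem [FiniteDimensional ℝ E] {f : E → ℝ} {C : Set (E →L[ℝ] ℝ)} {y : E}
    (h : HasSlopesIn f C y) (hconv : Convex ℝ C) (hC : IsCompact C)
    (hf : DifferentiableAt ℝ f y) : fderiv ℝ f y ∈ C := by
  by_contra hnot
  -- A separating functional on the dual space is the evaluation at a vector.
  obtain ⟨l, c, hlC, hl⟩ := geometric_hahn_banach_closed_point hconv hC.isClosed hnot
  obtain ⟨v, hv⟩ : ∃ v : E, ∀ p : E →L[ℝ] ℝ, l p = p v := by
    let e : (E →ₗ[ℝ] ℝ) ≃ₗ[ℝ] (E →L[ℝ] ℝ) := LinearMap.toContinuousLinearMap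
    obtain ⟨v, hv⟩ := (Module.evalEquiv ℝ E).surjective (l.toLinearMap ∘ₗ e.toLinearMap)
    refine ⟨v, fun p => ?_⟩
    have := congrArg (fun k => k (e.symm p)) hv
    rw [Module.evalEquiv_apply, Module.Dual.eval_apply] at this
    calc l p = l (e (e.symm p)) := by rw [e.apply_symm_apply]
      _ = (e.symm p) v := this.symm
      _ = p v := rfl
  have hne : C.Nonempty := by
    obtain ⟨p, hp, -⟩ := h.self_of_nhds
    exact ⟨p, hp⟩
  obtain ⟨m, M, hmM⟩ := hconv.exists_clm_apply_eq_iff_mem_Icc hC hne v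
  have hlim := (hf.hasFDerivAt.hasLineDerivAt v).tendsto_slope_zero_right
  have hpath : Tendsto (fun t : ℝ => (y, y + t • v)) (𝓝[>] 0) (𝓝 (y, y)) := by
    have : Continuous fun t : ℝ => (y, y + t • v) := by fun_prop
    simpa using (this.tendsto 0).mono_left nhdsWithin_le_nhds
  have hmem : ∀ᶠ t : ℝ in 𝓝[>] 0, t⁻¹ • (f (y + t • v) - f y) ∈ Icc m M := by
    filter_upwards [hpath.eventually h, self_mem_nhdsWithin] with t ht ht0
    obtain ⟨p, hp, hpe⟩ := ht
    refine (hmM _).1 ⟨p, hp, ?_⟩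
    have ht0' : t ≠ 0 := (mem_Ioi.1 ht0).ne'
    simp only [add_sub_cancel_left, map_smul] at hpe
    rw [hpe, smul_smul, inv_mul_cancel₀ ht0', one_smul]
  obtain ⟨p, hp, hpe⟩ := (hmM _).2 (isClosed_Icc.mem_of_tendsto hlim hmem)
  have h1 := hlC p hp
  rw [hv, ← hpe, ← hv] at h1
  exact lt_asymm h1 hl

/-- Interpolating between two functions with slopes in the same convex set `C` keeps the slopes
in `C`, up to an error controlled by the distance of the two functions. -/
theorem exists_mem_cthickening_interpolate {C : Set (E →L[ℝ] ℝ)} (hconv : Convex ℝ C)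
    {f w G : E → ℝ} {a b : E} {L e η : ℝ}
    (hf : ∃ p ∈ C, f b - f a = p (b - a)) (hw : ∃ p ∈ C, w b - w a = p (b - a))
    (hG : G b ∈ Icc (0 : ℝ) 1) (hGL : |G b - G a| ≤ L * ‖b - a‖) (hwf : |w a - f a| ≤ e)
    (hη : 0 ≤ η) (hLe : e * L ≤ η) :
    ∃ p ∈ cthickening η C,
      (f b + G b * (w b - f b)) - (f a + G a * (w a - f a)) = p (b - a) := by
  obtain ⟨p, hp, hpe⟩ := hf
  obtain ⟨q, hq, hqe⟩ := hw
  have hpq : (1 - G b) • p + G b • q ∈ C :=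
    hconv hp hq (sub_nonneg.2 hG.2) hG.1 (by ring)
  obtain ⟨p', hp', hpe'⟩ := exists_mem_cthickening_apply_eq (η := η) hpq (v := b - a)
    (e := (w a - f a) * (G b - G a)) (by
      rw [abs_mul]
      calc _ ≤ e * (L * ‖b - a‖) := by gcongr; exact (abs_nonneg _).trans hwf
        _ = e * L * ‖b - a‖ := by ring
        _ ≤ _ := by gcongr) hη
  refine ⟨p', hp', ?_⟩
  rw [← hpe']
  simp only [add_apply, smul_apply, smul_eq_mul, ← hpe, ← hqe]
  ring

theorem sub_mem_ball_of_mem_ball {F : Type*} [SeminormedAddCommGroup F] {a y t : F}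
    {r s : ℝ} (ha : a ∈ ball y (r - s))
    (ht : t ∈ ball (0 : F) s) : a - t ∈ ball y r := by
  rw [mem_ball, dist_eq_norm] at *
  calc ‖a - t - y‖ = ‖(a - y) - (t - 0)‖ := by congr 1; abel
    _ ≤ ‖a - y‖ + ‖t - 0‖ := norm_sub_le _ _
    _ < r := by linarith

variable [FiniteDimensional ℝ E] [MeasurableSpace E] [BorelSpace E]

/-- The mollification of `f` by the normalized bump function `ψ`. -/
noncomputable def mollify (ψ : ContDiffBump (0 : E)) (f : E → ℝ) : E → ℝ :=
  convolution (ψ.normed Measure.addHaar) f (lsmul ℝ ℝ) Measure.addHaar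

theorem mollify_apply (ψ : ContDiffBump (0 : E)) (f : E → ℝ) (x : E) :
    mollify ψ f x = ∫ t, ψ.normed Measure.addHaar t * f (x - t) ∂Measure.addHaar := by
  simp [mollify, convolution]

theorem contDiff_mollify (ψ : ContDiffBump (0 : E)) {f : E → ℝ}
    (hf : LocallyIntegrable f Measure.addHaar) : ContDiff ℝ ∞ (mollify ψ f) :=
  ψ.hasCompactSupport_normed.contDiff_convolution_left _ ψ.contDiff_normed hf

theorem integrable_mollify_integrand (ψ : ContDiffBump (0 : E)) {f : E → ℝ}
    (hf : LocallyIntegrable f Measure.addHaar) (x : E) :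
    Integrable (fun t => ψ.normed Measure.addHaar t * f (x - t)) Measure.addHaar := by
  have := ψ.hasCompactSupport_normed.convolutionExists_left (lsmul ℝ ℝ)
    (ψ.contDiff_normed (n := 0) (μ := Measure.addHaar)).continuous hf x
  simpa [ConvolutionExistsAt] using this

/-- An average against a normalized bump function lies between the bounds of the integrand. -/
theorem integral_normed_mul_mem_Icc (ψ : ContDiffBump (0 : E)) {h : E → ℝ} {m M : ℝ}
    (hi : Integrable (fun t => ψ.normed Measure.addHaar t * h t) Measure.addHaar)
    (hm : ∀ᵐ t ∂Measure.addHaar, t ∈ ball (0 : E) ψ.rOut → h t ∈ Icc m M) :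
    ∫ t, ψ.normed Measure.addHaar t * h t ∂Measure.addHaar ∈ Icc m M := by
  have hint : ∀ c : ℝ, ∫ t, ψ.normed Measure.addHaar t * c ∂Measure.addHaar = c := fun c => by
    rw [integral_mul_const, ψ.integral_normed, one_mul]
  have hc : ∀ c : ℝ, Integrable (fun t => ψ.normed Measure.addHaar t * c) Measure.addHaar :=
    fun c => ψ.integrable_normed.mul_const c
  have key : ∀ᵐ t ∂Measure.addHaar, ψ.normed Measure.addHaar t * m ≤
      ψ.normed Measure.addHaar t * h t ∧
      ψ.normed Measure.addHaar t * h t ≤ ψ.normed Measure.addHaar t * M := by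
    filter_upwards [hm] with t ht
    by_cases htb : t ∈ ball (0 : E) ψ.rOut
    · have := ψ.nonneg_normed (μ := Measure.addHaar) t
      exact ⟨mul_le_mul_of_nonneg_left (ht htb).1 this, mul_le_mul_of_nonneg_left (ht htb).2 this⟩
    · have : ψ.normed Measure.addHaar t = 0 := by
        rw [← Function.notMem_support, ψ.support_normed_eq]
        exact htb
      simp [this]
  refine ⟨?_, ?_⟩
  · rw [← hint m]
    exact integral_mono_ae (hc m) hi (key.mono fun t h => h.1)
  · rw [← hint M]
    exact integral_mono_ae hi (hc M) (key.mono fun t h => h.2)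

/-- Mollification keeps the slopes in a compact convex set. -/
theorem mollify_sub_mollify_eq_apply (ψ : ContDiffBump (0 : E)) {f : E → ℝ}
    (hf : LocallyIntegrable f Measure.addHaar) {C : Set (E →L[ℝ] ℝ)} (hconv : Convex ℝ C)
    (hC : IsCompact C) {y : E} {r : ℝ}
    (h : ∀ a ∈ ball y r, ∀ b ∈ ball y r, ∃ p ∈ C, f b - f a = p (b - a))
    {a b : E} (ha : a ∈ ball y (r - ψ.rOut)) (hb : b ∈ ball y (r - ψ.rOut)) :
    ∃ p ∈ C, mollify ψ f b - mollify ψ f a = p (b - a) := by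
  have h0 : (0 : E) ∈ ball (0 : E) ψ.rOut := mem_ball_self ψ.rOut_pos
  have hne : C.Nonempty := by
    obtain ⟨p, hp, -⟩ := h _ (sub_mem_ball_of_mem_ball ha h0) _ (sub_mem_ball_of_mem_ball hb h0)
    exact ⟨p, hp⟩
  obtain ⟨m, M, hmM⟩ := hconv.exists_clm_apply_eq_iff_mem_Icc hC hne (b - a)
  rw [hmM, mollify_apply, mollify_apply,
    ← integral_sub (integrable_mollify_integrand ψ hf b) (integrable_mollify_integrand ψ hf a)]
  simp only [← mul_sub]
  refine integral_normed_mul_mem_Icc ψ ?_ (Eventually.of_forall fun t ht => ?_)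
  · simp only [mul_sub]
    exact (integrable_mollify_integrand ψ hf b).sub (integrable_mollify_integrand ψ hf a)
  · rw [← hmM]
    obtain ⟨p, hp, hpe⟩ := h _ (sub_mem_ball_of_mem_ball ha ht) _ (sub_mem_ball_of_mem_ball hb ht)
    exact ⟨p, hp, by rw [hpe, sub_sub_sub_cancel_right]⟩

theorem abs_mollify_sub_le (ψ : ContDiffBump (0 : E)) {f : E → ℝ}
    (hf : LocallyIntegrable f Measure.addHaar) {a : E} {e : ℝ}
    (h : ∀ b ∈ ball a ψ.rOut, |f b - f a| ≤ e) : |mollify ψ f a - f a| ≤ e :=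
  ψ.dist_normed_convolution_le hf.aestronglyMeasurable h

/-- Near a point where the slopes of `f` lie in `C`, replacing `f` by its mollification through a
cutoff function `G` moves the slopes and the values of `f` arbitrarily little, once the radius of
the mollifier is small. -/
theorem HasSlopesIn.eventually_mollify {f : E → ℝ} (hf : LocallyIntegrable f Measure.addHaar)
    {C : Set (E →L[ℝ] ℝ)} (hconv : Convex ℝ C) (hC : IsCompact C) {y : E}
    (h : HasSlopesIn f C y) {G : E → ℝ} (hG : ContDiffAt ℝ 1 G y)
    (hG01 : ∀ z, G z ∈ Icc (0 : ℝ) 1) {η e : ℝ} (hη : 0 < η) (he : 0 < e) :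
    ∀ᶠ q : ℝ × E in 𝓝 (0, y), ∀ ψ : ContDiffBump (0 : E), ψ.rOut < q.1 →
      HasSlopesIn (fun z => f z + G z * (mollify ψ f z - f z)) (cthickening η C) q.2 ∧
        |mollify ψ f q.2 - f q.2| ≤ e := by
  obtain ⟨R, hR, hCR⟩ := hC.exists_norm_le_clm
  obtain ⟨r₁, hr₁, h⟩ := hasSlopesIn_iff_ball.1 h
  obtain ⟨L, s, hs, hL⟩ := hG.exists_lipschitzOnWith
  obtain ⟨r₂, hr₂, hr₂s⟩ := Metric.mem_nhds_iff.1 hs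
  set r := min r₁ r₂ with hr_def
  have hr : 0 < r := lt_min hr₁ hr₂
  -- For `ψ.rOut < δ`, the error of the mollification is at most `R * δ`; it has to be at most `e`,
  -- and at most `η` when multiplied by the Lipschitz constant `L` of `G`.
  set δ := min (r / 2) (min (e / R) (η / (R * (L + 1)))) with hδ_def
  have hL1 : (0 : ℝ) < L + 1 := by positivity
  have hδ : 0 < δ := by positivity
  have hδr : δ ≤ r / 2 := min_le_left _ _
  have hδe : R * δ ≤ e := by
    calc R * δ ≤ R * (e / R) := by
          gcongr; exact (min_le_right _ _).trans (min_le_left _ _)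
      _ = e := by field_simp
  have hδη : R * δ * L ≤ η := by
    calc R * δ * L ≤ R * (η / (R * (L + 1))) * (L + 1) := by
          gcongr
          · exact (min_le_right _ _).trans (min_le_right _ _)
          · linarith
      _ = η := by field_simp
  have hev : ∀ᶠ q : ℝ × E in 𝓝 (0, y), q.1 < δ ∧ q.2 ∈ ball y (r / 2) :=
    (prod_mem_nhds (Iio_mem_nhds hδ) (ball_mem_nhds y (half_pos hr)))
  filter_upwards [hev] with q hq ψ hψ
  have hψδ : ψ.rOut < δ := hψ.trans hq.1
  have hsub : ball y (r / 2) ⊆ ball y (r₁ - ψ.rOut) :=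
    ball_subset_ball (by have := min_le_left r₁ r₂; linarith)
  have hclose : ∀ a ∈ ball y (r / 2), |mollify ψ f a - f a| ≤ R * δ := fun a ha => by
    refine abs_mollify_sub_le ψ hf fun b hb => ?_
    have har : a ∈ ball y r₁ := ball_subset_ball
      (by have := min_le_left r₁ r₂; linarith) ha
    have hbr : b ∈ ball y r₁ := by
      rw [mem_ball] at *
      have := min_le_left r₁ r₂
      linarith [dist_triangle b a y]
    obtain ⟨p, hp, hpe⟩ := h a har b hbr
    rw [hpe, ← Real.norm_eq_abs]
    refine p.le_of_opNorm_le_of_le (hCR p hp) ?_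
    rw [mem_ball, dist_eq_norm] at hb
    linarith
  refine ⟨?_, (hclose _ hq.2).trans hδe⟩
  have hnhds : ball y (r / 2) ×ˢ ball y (r / 2) ∈ 𝓝 (q.2, q.2) :=
    prod_mem_nhds (isOpen_ball.mem_nhds hq.2) (isOpen_ball.mem_nhds hq.2)
  filter_upwards [hnhds] with ab hab
  have hab1 : ∀ {x : E}, x ∈ ball y (r / 2) → x ∈ ball y r₁ ∧ x ∈ s := fun hx =>
    ⟨ball_subset_ball (by have := min_le_left r₁ r₂; linarith) hx,
      hr₂s (ball_subset_ball (by have := min_le_right r₁ r₂; linarith) hx)⟩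
  refine exists_mem_cthickening_interpolate hconv (h _ (hab1 hab.1).1 _ (hab1 hab.2).1)
    (mollify_sub_mollify_eq_apply ψ hf hconv hC h (hsub hab.1) (hsub hab.2)) (hG01 _)
    (L := L) ?_ (hclose _ hab.1) hη.le hδη
  rw [← dist_eq_norm, ← Real.dist_eq]
  exact hL.dist_le_mul _ (hab1 hab.2).2 _ (hab1 hab.1).2

/-- The derivative of a mollified Lipschitz function is an average of derivatives. A bound for
these at the points of differentiability is enough, because almost every point is one by
Rademacher's theorem. -/
theorem fderiv_mollify_apply_mem_Icc (ψ : ContDiffBump (0 : E)) {f : E → ℝ} {K : NNReal}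
    (hf : LipschitzWith K f) {y v : E} {r m M : ℝ}
    (h : ∀ z ∈ ball y r, DifferentiableAt ℝ f z → fderiv ℝ f z v ∈ Icc m M)
    {x : E} (hx : x ∈ ball y (r - ψ.rOut)) : fderiv ℝ (mollify ψ f) x v ∈ Icc m M := by
  have hfi : LocallyIntegrable f Measure.addHaar := hf.continuous.locallyIntegrable
  have hg : LipschitzWith K fun t => f (x - t) :=
    LipschitzWith.of_dist_le_mul fun a b => by
      have h1 := hf.dist_le_mul (x - a) (x - b)
      rwa [dist_sub_left] at h1
  have hψi := ψ.integrable_normed (μ := Measure.addHaar)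
  have hlim := hg.integral_inv_smul_sub_mul_tendsto_integral_lineDeriv_mul hψi (-v)
  have hd : DifferentiableAt ℝ (mollify ψ f) x :=
    (contDiff_mollify ψ hfi).contDiffAt.differentiableAt (by simp)
  have hlim' := (hd.hasFDerivAt.hasLineDerivAt v).tendsto_slope_zero_right
  have heq : (fun s : ℝ => ∫ t, (s⁻¹ • (f (x - (t + s • -v)) - f (x - t))) *
      ψ.normed Measure.addHaar t ∂Measure.addHaar) =
      fun s : ℝ => s⁻¹ • (mollify ψ f (x + s • v) - mollify ψ f x) := by
    funext s
    rw [mollify_apply, mollify_apply, ← integral_sub (integrable_mollify_integrand ψ hfi _)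
      (integrable_mollify_integrand ψ hfi _), ← integral_smul]
    congr 1
    funext t
    have : x - (t + s • -v) = x + s • v - t := by rw [smul_neg]; abel
    rw [this]
    simp only [smul_eq_mul]
    ring
  rw [heq] at hlim
  rw [tendsto_nhds_unique hlim' hlim]
  have hmeas : Integrable (fun t => ψ.normed Measure.addHaar t *
      lineDeriv ℝ (fun t => f (x - t)) t (-v)) Measure.addHaar := by
    refine (hψi.norm.mul_const (K * ‖-v‖)).mono' ?_ (Eventually.of_forall fun t => ?_)
    · exact hψi.aestronglyMeasurable.mul
        (aestronglyMeasurable_lineDeriv hg.continuous _)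
    · rw [norm_mul]
      gcongr
      exact norm_lineDeriv_le_of_lipschitz ℝ hg
  simp only [mul_comm _ (ψ.normed Measure.addHaar _)]
  refine integral_normed_mul_mem_Icc ψ hmeas ?_
  filter_upwards [hg.ae_differentiableAt (μ := Measure.addHaar)] with t ht htb
  have hdiff : DifferentiableAt ℝ f (x - t) := by
    have h1 : f = (fun t => f (x - t)) ∘ fun z => x - z := by funext z; simp
    rw [h1]
    refine DifferentiableAt.comp _ ?_ (by fun_prop)
    simpa using ht
  have hline : lineDeriv ℝ (fun t => f (x - t)) t (-v) = lineDeriv ℝ f (x - t) v := by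
    unfold lineDeriv
    congr 1
    funext s
    exact congrArg f (by module)
  rw [hline, hdiff.lineDeriv_eq_fderiv]
  exact h _ (sub_mem_ball_of_mem_ball hx htb) hdiff

/-- If the derivatives of a Lipschitz function `f` at the points of differentiability near `y` lie
in the compact convex set `C`, then so do the slopes of `f` near `y`. By Rademacher's theorem this
follows from the mean value theorem for mollifications of `f`. -/
theorem hasSlopesIn_of_fderiv_mem {f : E → ℝ} {K : NNReal} {s : Set E} {y : E} (hs : s ∈ 𝓝 y)
    (hf : LipschitzOnWith K f s) {C : Set (E →L[ℝ] ℝ)} (hconv : Convex ℝ C) (hC : IsCompact C)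
    (h : ∀ᶠ z in 𝓝 y, DifferentiableAt ℝ f z → fderiv ℝ f z ∈ C) : HasSlopesIn f C y := by
  obtain ⟨g, hg, hfg⟩ := hf.extend_real
  have hgf : g =ᶠ[𝓝 y] f := by filter_upwards [hs] with z hz using (hfg hz).symm
  refine HasSlopesIn.congr ?_ hgf
  obtain ⟨r, hr, hball⟩ := Metric.eventually_nhds_iff_ball.1 (h.and hgf.eventually_nhds)
  have hgC : ∀ z ∈ ball y r, DifferentiableAt ℝ g z → fderiv ℝ g z ∈ C := fun z hz hd => by
    have he : g =ᶠ[𝓝 z] f := (hball z hz).2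
    rw [he.fderiv_eq]
    exact (hball z hz).1 (he.differentiableAt_iff.1 hd)
  have hne : C.Nonempty := by
    obtain ⟨z, hzd, hz⟩ := (Measure.dense_of_ae
      (hg.ae_differentiableAt (μ := Measure.addHaar))).exists_mem_open isOpen_ball
        ⟨y, mem_ball_self hr⟩
    exact ⟨_, hgC z hz hzd⟩
  refine hasSlopesIn_iff_ball.2 ⟨r / 2, half_pos hr, fun a ha b hb => ?_⟩
  obtain ⟨m, M, hmM⟩ := hconv.exists_clm_apply_eq_iff_mem_Icc hC hne (b - a)
  rw [hmM]
  have hfi : LocallyIntegrable g Measure.addHaar := hg.continuous.locallyIntegrable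
  have happrox : ∀ δ > 0, δ < r / 2 →
      g b - g a ∈ Icc (m - 2 * (K * δ)) (M + 2 * (K * δ)) := fun δ hδ hδr => by
    let ψ : ContDiffBump (0 : E) := ⟨δ / 2, δ, half_pos hδ, half_lt_self hδ⟩
    have hclose : ∀ x, |mollify ψ g x - g x| ≤ K * δ := fun x => by
      refine abs_mollify_sub_le ψ hfi fun z hz => ?_
      rw [← Real.dist_eq]
      refine (hg.dist_le_mul z x).trans ?_
      gcongr
      exact (mem_ball.1 hz).le
    have hsub : ball y (r / 2) ⊆ ball y (r - ψ.rOut) :=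
      ball_subset_ball (by change r / 2 ≤ r - δ; linarith)
    have hder : ∀ x ∈ ball y (r / 2), HasFDerivWithinAt (mollify ψ g)
        (fderiv ℝ (mollify ψ g) x) (ball y (r / 2)) x := fun x _ =>
      ((contDiff_mollify ψ hfi).contDiffAt.differentiableAt
        (by simp)).hasFDerivAt.hasFDerivWithinAt
    obtain ⟨z, hz, hze⟩ := domain_mvt hder (convex_ball y (r / 2)) ha hb
    have hzb : z ∈ ball y (r / 2) := (convex_ball y (r / 2)).segment_subset ha hb hz
    have hmem := fderiv_mollify_apply_mem_Icc ψ hg (v := b - a) (m := m) (M := M)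
      (fun z hz hd => (hmM _).1 ⟨_, hgC z hz hd, rfl⟩) (hsub hzb)
    rw [← hze] at hmem
    have h1 := abs_le.1 (hclose a)
    have h2 := abs_le.1 (hclose b)
    constructor <;> [linarith [hmem.1]; linarith [hmem.2]]
  have hev : ∀ᶠ δ : ℝ in 𝓝[>] 0,
      g b - g a ∈ Icc (m - 2 * (K * δ)) (M + 2 * (K * δ)) := by
    filter_upwards [self_mem_nhdsWithin, nhdsWithin_le_nhds (Iio_mem_nhds (half_pos hr))]
      with δ h1 h2 using happrox δ h1 h2
  have hm : Tendsto (fun δ : ℝ => m - 2 * (K * δ)) (𝓝[>] 0) (𝓝 m) := by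
    have : Continuous fun δ : ℝ => m - 2 * (K * δ) := by fun_prop
    simpa using (this.tendsto 0).mono_left nhdsWithin_le_nhds
  have hM : Tendsto (fun δ : ℝ => M + 2 * (K * δ)) (𝓝[>] 0) (𝓝 M) := by
    have : Continuous fun δ : ℝ => M + 2 * (K * δ) := by fun_prop
    simpa using (this.tendsto 0).mono_left nhdsWithin_le_nhds
  exact ⟨le_of_tendsto hm (hev.mono fun _ h => h.1), ge_of_tendsto hM (hev.mono fun _ h => h.2)⟩

end VectorSpace

/-! ### Admissible functions on a manifold -/

section Manifold

open Metric

variable {E : Type*} [NormedAddCommGroup E] {N : Type*} [TopologicalSpace N] [ChartedSpace E N]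

theorem eventuallyEq_comp_chart (u : N → ℝ) {c x : N} (hx : x ∈ (chartAt E c).source) :
    u =ᶠ[𝓝 x] (u ∘ (chartAt E c).symm) ∘ chartAt E c := by
  filter_upwards [(chartAt E c).open_source.mem_nhds hx] with z hz
  simp [(chartAt E c).left_inv hz]

theorem eventually_comp_chart_symm_eq {w w' : N → ℝ} {c x : N} (hx : x ∈ (chartAt E c).source)
    (h : w =ᶠ[𝓝 x] w') :
    w ∘ (chartAt E c).symm =ᶠ[𝓝 (chartAt E c x)] w' ∘ (chartAt E c).symm :=
  h.comp_tendsto ((chartAt E c).tendsto_symm hx)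

variable [NormedSpace ℝ E] [IsManifold 𝓘(ℝ, E) ∞ N]

/-- The covector at `x` whose expression in the chart at `c` is the linear form `p`. -/
noncomputable def chartCovector (c x : N) (p : E →L[ℝ] ℝ) : CotangentSpace E x :=
  (p.comp (tangentCoordChange 𝓘(ℝ, E) x c x) : E →L[ℝ] ℝ)

theorem isDiffAt_iff_chart {u : N → ℝ} {c x : N} (hx : x ∈ (chartAt E c).source) :
    IsDiffAt E u x ↔ DifferentiableAt ℝ (u ∘ (chartAt E c).symm) (chartAt E c x) := by
  rw [← mdifferentiableAt_iff_differentiableAt]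
  have hx' : chartAt E c x ∈ (chartAt E c).target := (chartAt E c).map_source hx
  refine ⟨fun h => ?_, fun h => ?_⟩
  · refine MDifferentiableAt.comp (I' := 𝓘(ℝ, E)) _ ?_
      (mdifferentiableAt_atlas_symm (I := 𝓘(ℝ, E)) (chart_mem_atlas E c) hx')
    rwa [(chartAt E c).left_inv hx]
  · exact (h.comp x (mdifferentiableAt_atlas (I := 𝓘(ℝ, E))
      (chart_mem_atlas E c) hx)).congr_of_eventuallyEq (eventuallyEq_comp_chart u hx)

theorem differential_eq_chartCovector {u : N → ℝ} {c x : N} (hx : x ∈ (chartAt E c).source)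
    (hu : IsDiffAt E u x) :
    differential E u x =
      chartCovector c x (fderiv ℝ (u ∘ (chartAt E c).symm) (chartAt E c x)) := by
  have h1 : MDifferentiableAt 𝓘(ℝ, E) 𝓘(ℝ, E) (chartAt E c) x :=
    mdifferentiableAt_atlas (chart_mem_atlas E c) hx
  have h2 := (isDiffAt_iff_chart hx).1 hu
  have h4 := mfderiv_comp x (h2.mdifferentiableAt) h1
  rw [← (eventuallyEq_comp_chart u hx).mfderiv_eq] at h4
  rw [mfderiv_chartAt_eq_tangentCoordChange hx, mfderiv_eq_fderiv] at h4
  exact h4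

theorem chartCovector_self (x : N) (p : E →L[ℝ] ℝ) : chartCovector x x p = p := by
  ext v
  have h := tangentCoordChange_self (I := 𝓘(ℝ, E)) (x := x) (z := x) (v := v)
    (mem_extChartAt_source x)
  exact congrArg p h

theorem chartCovector_comp_tangentCoordChange {c c' x : N} (hx : x ∈ (chartAt E c).source)
    (hx' : x ∈ (chartAt E c').source) (p : E →L[ℝ] ℝ) :
    chartCovector c' x (p ∘L tangentCoordChange 𝓘(ℝ, E) c' c x) = chartCovector c x p := by
  ext v
  have h := tangentCoordChange_comp (I := 𝓘(ℝ, E)) (w := x) (x := c') (y := c) (z := x) (v := v)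
    (by simp [hx, hx'])
  exact congrArg p h

/-- Points of the cotangent bundle depend continuously on their base point and on their coordinates
in the chart at `c`. -/
theorem continuousAt_chartCovector {c x : N} (hx : x ∈ (chartAt E c).source) (p : E →L[ℝ] ℝ) :
    ContinuousAt
      (fun q : N × (E →L[ℝ] ℝ) => (⟨q.1, chartCovector c q.1 q.2⟩ : CotangentBundle E N))
      (x, p) := by
  rw [continuousAt_hom_bundle]
  refine ⟨continuousAt_fst, ?_⟩
  have hA : ContinuousAt (tangentCoordChange 𝓘(ℝ, E) x c) x := by
    refine (continuousOn_tangentCoordChange x c).continuousAt ?_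
    refine ((isOpen_extChartAt_source x).inter (isOpen_extChartAt_source c)).mem_nhds ?_
    simp [hx]
  have hcont : ContinuousAt (fun q : N × (E →L[ℝ] ℝ) => q.2 ∘L tangentCoordChange 𝓘(ℝ, E) x c q.1)
      (x, p) :=
    continuousAt_snd.clm_comp (hA.comp_of_eq continuousAt_fst rfl)
  refine hcont.congr ?_
  have hev : ∀ᶠ q : N × (E →L[ℝ] ℝ) in 𝓝 (x, p),
      q.1 ∈ (chartAt E c).source ∧ q.1 ∈ (chartAt E x).source :=
    continuousAt_fst.eventually_mem (((chartAt E c).open_source.inter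
      (chartAt E x).open_source).mem_nhds ⟨hx, mem_chart_source E x⟩)
  filter_upwards [hev] with q hq
  ext v
  have h := tangentCoordChange_comp (I := 𝓘(ℝ, E)) (w := x) (x := q.1) (y := c) (z := q.1) (v := v)
    (by simp [hq.1, hq.2])
  have hsymm := congrArg (fun l => chartCovector c q.1 q.2 (l v))
    (TangentBundle.symmL_trivializationAt_eq_core (I := 𝓘(ℝ, E)) hq.2)
  rw [ContinuousLinearMap.comp_apply, ← h]
  refine hsymm.symm.trans ?_
  simp [ContinuousLinearMap.inCoordinates]

/-- The transition map between two charts has the coordinate change of the tangent bundle as its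
strict derivative. -/
theorem hasStrictFDerivAt_chart_transition {c c' x : N} (hx : x ∈ (chartAt E c).source)
    (hx' : x ∈ (chartAt E c').source) :
    HasStrictFDerivAt (chartAt E c ∘ (chartAt E c').symm) (tangentCoordChange 𝓘(ℝ, E) c' c x)
      (chartAt E c' x) := by
  have h := hasFDerivWithinAt_tangentCoordChange (I := 𝓘(ℝ, E)) (x := c') (y := c) (z := x)
    (by simp [hx, hx'])
  simp only [mfld_simps, hasFDerivWithinAt_univ] at h
  have hs : ContDiffAt ℝ ∞ (chartAt E c ∘ (chartAt E c').symm) (chartAt E c' x) := by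
    have := contDiffWithinAt_ext_coord_change (I := 𝓘(ℝ, E)) (n := ∞) c c'
      (y := chartAt E c' x) (by 
        simp [hx, (chartAt E c').left_inv hx', (chartAt E c').map_source hx'])
    simpa [contDiffWithinAt_univ] using this
  exact hs.hasStrictFDerivAt' h (by simp)

/-- The function `w` is admissible at `x`, as seen in the chart at `c`: near `x` its slopes
lie in a compact convex set of linear forms, and `H` is negative on the corresponding covectors
at `x`. -/
def IsAdmissibleAt (H : CotangentBundle E N → ℝ) (c x : N) (w : N → ℝ) : Prop :=
  ∃ C : Set (E →L[ℝ] ℝ), IsCompact C ∧ Convex ℝ C ∧ (∀ p ∈ C, H ⟨x, chartCovector c x p⟩ < 0) ∧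
    HasSlopesIn (w ∘ (chartAt E c).symm) C (chartAt E c x)

theorem IsAdmissibleAt.congr {H : CotangentBundle E N → ℝ} {c x : N} {w w' : N → ℝ}
    (h : IsAdmissibleAt H c x w) (hx : x ∈ (chartAt E c).source) (hw : w =ᶠ[𝓝 x] w') :
    IsAdmissibleAt H c x w' := by
  obtain ⟨C, hC, hconv, hneg, hs⟩ := h
  exact ⟨C, hC, hconv, hneg, hs.congr (eventually_comp_chart_symm_eq hx hw)⟩

/-- Negativity of `H` on a compact set of covectors at `x` persists on a thickening, at nearby
points. -/
theorem exists_thickening_neg {U : Set N} (hU : IsOpen U) {H : CotangentBundle E N → ℝ}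
    (hH : ContinuousOn H {z : CotangentBundle E N | z.1 ∈ U}) {c x : N} (hxU : x ∈ U)
    (hx : x ∈ (chartAt E c).source) {C : Set (E →L[ℝ] ℝ)} (hC : IsCompact C)
    (hneg : ∀ p ∈ C, H ⟨x, chartCovector c x p⟩ < 0) :
    ∃ η > 0, ∀ᶠ z in 𝓝 x, ∀ p ∈ cthickening η C, H ⟨z, chartCovector c z p⟩ < 0 := by
  have hev := hC.eventually_forall_of_forall_eventually (x₀ := (x, (0 : E →L[ℝ] ℝ)))
    (P := fun zq p => H ⟨zq.1, chartCovector c zq.1 (p + zq.2)⟩ < 0) fun p hp => by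
      have h1 : ContinuousAt (fun q : N × (E →L[ℝ] ℝ) =>
          H (⟨q.1, chartCovector c q.1 q.2⟩ : CotangentBundle E N)) (x, p) := by
        have hpre : IsOpen {z : CotangentBundle E N | z.1 ∈ U} :=
          hU.preimage (FiberBundle.continuous_proj (E →L[ℝ] ℝ) fun x : N => CotangentSpace E x)
        exact (hH.continuousAt (x := ⟨x, chartCovector c x p⟩) (hpre.mem_nhds hxU)).comp_of_eq
          (continuousAt_chartCovector hx p) rfl
      have h2 : Tendsto (fun z : (N × (E →L[ℝ] ℝ)) × (E →L[ℝ] ℝ) => (z.1.1, z.2 + z.1.2))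
          (𝓝 ((x, 0), p)) (𝓝 (x, p)) := by
        have : Continuous fun z : (N × (E →L[ℝ] ℝ)) × (E →L[ℝ] ℝ) => (z.1.1, z.2 + z.1.2) := by
          fun_prop
        simpa using this.tendsto ((x, 0), p)
      exact h2.eventually (h1.eventually_lt_const (hneg p hp))
  rw [nhds_prod_eq] at hev
  obtain ⟨P, hP, Q, hQ, hPQ⟩ := eventually_prod_iff.1 hev
  obtain ⟨η, hη, hball⟩ := Metric.nhds_basis_closedBall.eventually_iff.1 hQ
  refine ⟨η, hη, hP.mono fun z hz p hp => ?_⟩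
  rw [IsCompact.cthickening_eq_biUnion_closedBall hC hη.le, mem_iUnion₂] at hp
  obtain ⟨a, ha, hpa⟩ := hp
  simpa using hPQ hz (hball (x := p - a) (by simpa [dist_eq_norm] using hpa)) a ha

/-- Admissibility does not depend on the chart. -/
theorem IsAdmissibleAt.change_chart [FiniteDimensional ℝ E] {U : Set N} (hU : IsOpen U)
    {H : CotangentBundle E N → ℝ}
    (hH : ContinuousOn H {z : CotangentBundle E N | z.1 ∈ U}) {c c' x : N} (hxU : x ∈ U)
    (hx : x ∈ (chartAt E c).source) (hx' : x ∈ (chartAt E c').source) {w : N → ℝ}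
    (h : IsAdmissibleAt H c x w) : IsAdmissibleAt H c' x w := by
  obtain ⟨C, hC, hconv, hneg, hs⟩ := h
  set A := tangentCoordChange 𝓘(ℝ, E) c' c x with hA
  set D : Set (E →L[ℝ] ℝ) := (fun p => p ∘L A) '' C with hD
  have hDc : IsCompact D := hC.image (by fun_prop)
  have hDconv : Convex ℝ D :=
    hconv.is_linear_image ⟨fun p q => ContinuousLinearMap.add_comp p q A,
      fun r p => ContinuousLinearMap.smul_comp r p A⟩
  obtain ⟨η, hη, hev⟩ := exists_thickening_neg hU hH hxU hx' hDc (by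
    rintro _ ⟨p, hp, rfl⟩
    rw [chartCovector_comp_tangentCoordChange hx hx']
    exact hneg p hp)
  refine ⟨cthickening η D, hDc.cthickening, hDconv.cthickening η, hev.self_of_nhds, ?_⟩
  have hτ := hasStrictFDerivAt_chart_transition hx hx'
  have hcomp := HasSlopesIn.comp_hasStrictFDerivAt
    (f := w ∘ (chartAt E c).symm) (C := C) (by simpa [(chartAt E c').left_inv hx'] using hs)
    hτ hC hη
  refine hcomp.congr ?_
  have hsrc : ∀ᶠ z in 𝓝 (chartAt E c' x), (chartAt E c').symm z ∈ (chartAt E c).source :=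
    ((chartAt E c').tendsto_symm hx').eventually ((chartAt E c).open_source.mem_nhds hx)
  filter_upwards [hsrc] with z hz
  simp [(chartAt E c).left_inv hz]

theorem IsAdmissibleAt.differential_neg [FiniteDimensional ℝ E] {H : CotangentBundle E N → ℝ}
    {c x : N} {w : N → ℝ} (h : IsAdmissibleAt H c x w) (hx : x ∈ (chartAt E c).source)
    (hw : IsDiffAt E w x) : H ⟨x, differential E w x⟩ < 0 := by
  obtain ⟨C, hC, hconv, hneg, hs⟩ := h
  rw [differential_eq_chartCovector hx hw]
  exact hneg _ (hs.fderiv_mem hconv hC ((isDiffAt_iff_chart hx).1 hw))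

/-- A locally Lipschitz function is admissible at `x` if `H` is negative on its Clarke derivative
at `x`. The compact convex set is a thickening of the convex hull of the limits of derivatives:
by compactness, the derivatives at the points of differentiability near `x` belong to it. -/
theorem isAdmissibleAt_of_clarke_neg [FiniteDimensional ℝ E] {u : N → ℝ}
    (hu : IsLocallyLipschitz E u) {U : Set N} (hU : IsOpen U) {H : CotangentBundle E N → ℝ}
    (hH : ContinuousOn H {z : CotangentBundle E N | z.1 ∈ U}) {x : N} (hxU : x ∈ U)
    (hneg : ∀ p ∈ clarkeDerivative E u x, H ⟨x, p⟩ < 0) : IsAdmissibleAt H x x u := by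
  obtain ⟨K, s, hs, hK⟩ := hu x
  set f := u ∘ (chartAt E x).symm with hf
  set y := chartAt E x x with hy
  have hxs : x ∈ (chartAt E x).source := mem_chart_source E x
  have hnorm : ∀ z ∈ interior s, ‖fderiv ℝ f z‖ ≤ K := fun z hz =>
    norm_fderiv_le_of_lipschitzOn ℝ (mem_interior_iff_mem_nhds.1 hz) hK
  set R : Set (E →L[ℝ] ℝ) := {p | ∃ z : ℕ → E, (∀ n, DifferentiableAt ℝ f (z n)) ∧
    (∀ n, z n ∈ interior s ∩ (chartAt E x).target) ∧ Tendsto z atTop (𝓝 y) ∧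
    Tendsto (fun n => fderiv ℝ f (z n)) atTop (𝓝 p)} with hR
  have hRreach : R ⊆ reachableDerivatives E u x := by
    rintro p ⟨z, hzd, hzs, hzy, hzp⟩
    have hsrc : ∀ n, (chartAt E x).symm (z n) ∈ (chartAt E x).source :=
      fun n => (chartAt E x).map_target (hzs n).2
    have hdiff : ∀ n, IsDiffAt E u ((chartAt E x).symm (z n)) := fun n => by
      rw [isDiffAt_iff_chart (hsrc n), (chartAt E x).right_inv (hzs n).2]
      exact hzd n
    refine ⟨fun n => (chartAt E x).symm (z n), hdiff, ?_⟩
    have hlim : Tendsto (fun n => ((chartAt E x).symm (z n), fderiv ℝ f (z n))) atTop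
        (𝓝 (x, p)) := by
      rw [nhds_prod_eq]
      exact (((chartAt E x).tendsto_symm hxs).comp hzy).prodMk hzp
    have := (continuousAt_chartCovector hxs p).tendsto.comp hlim
    rw [chartCovector_self] at this
    refine this.congr fun n => ?_
    simp only [Function.comp_apply]
    rw [differential_eq_chartCovector (hsrc n) (hdiff n), (chartAt E x).right_inv (hzs n).2]
  have hRbd : R ⊆ closedBall 0 K := by
    rintro p ⟨z, hzd, hzs, hzy, hzp⟩
    rw [mem_closedBall_zero_iff]
    exact le_of_tendsto hzp.norm (Eventually.of_forall fun n => hnorm _ (hzs n).1)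
  set C := closure (convexHull ℝ R) with hCdef
  have : ProperSpace (E →L[ℝ] ℝ) := FiniteDimensional.proper ℝ _
  have hCc : IsCompact C := (isCompact_closedBall (0 : E →L[ℝ] ℝ) K).of_isClosed_subset
    isClosed_closure
    (closure_minimal (convexHull_min hRbd (convex_closedBall 0 _)) isClosed_closedBall)
  have hCconv : Convex ℝ C := (convex_convexHull ℝ R).closure
  have hCclarke : ∀ p ∈ C, p ∈ clarkeDerivative E u x :=
    fun p hp => closure_mono (convexHull_mono hRreach) hp
  obtain ⟨η, hη, hev⟩ := exists_thickening_neg hU hH hxU hxs hCc (by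
    intro p hp
    rw [chartCovector_self]
    exact hneg p (hCclarke p hp))
  refine ⟨cthickening η C, hCc.cthickening, hCconv.cthickening η, hev.self_of_nhds, ?_⟩
  borelize E
  refine hasSlopesIn_of_fderiv_mem hs hK (hCconv.cthickening η) hCc.cthickening ?_
  by_contra hcon
  have hev' : ∀ᶠ z in 𝓝 y, z ∈ interior s ∩ (chartAt E x).target :=
    inter_mem (interior_mem_nhds.2 hs) (chart_target_mem_nhds E x)
  obtain ⟨z, hzy, hz⟩ := exists_seq_forall_of_frequently
    ((not_eventually.1 hcon).and_eventually hev')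
  obtain ⟨p, -, φ, hφ, hlim⟩ := (isCompact_closedBall (0 : E →L[ℝ] ℝ) K).tendsto_subseq
    (x := fun n => fderiv ℝ f (z n)) fun n => by
      rw [mem_closedBall_zero_iff]; exact hnorm _ (hz n).2.1
  have hpR : p ∈ R := ⟨z ∘ φ, fun n => by_contra fun h => (hz (φ n)).1 fun h' => absurd h' h,
    fun n => (hz (φ n)).2, hzy.comp hφ.tendsto_atTop, hlim⟩
  have hpC : p ∈ C := subset_closure (subset_convexHull ℝ R hpR)
  have hnhds : cthickening η C ∈ 𝓝 p :=
    mem_of_superset (isOpen_thickening.mem_nhds (self_subset_thickening hη C hpC))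
      (thickening_subset_cthickening η C)
  obtain ⟨n, hn⟩ := (hlim.eventually hnhds).exists
  exact (hz (φ n)).1 fun _ => hn

end Manifold

/-! ### Smoothing inside a chart -/

section Step

open Metric MeasureTheory

variable {E : Type*} [NormedAddCommGroup E] [NormedSpace ℝ E] [FiniteDimensional ℝ E]
  {N : Type*} [TopologicalSpace N] [ChartedSpace E N] [IsManifold 𝓘(ℝ, E) ∞ N]

omit [FiniteDimensional ℝ E] in
theorem ContMDiff.contDiffAt_comp_chart_symm {g : N → ℝ} (hg : ContMDiff 𝓘(ℝ, E) 𝓘(ℝ, ℝ) ∞ g)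
    {c : N} {y : E} (hy : y ∈ (chartAt E c).target) :
    ContDiffAt ℝ ∞ (g ∘ (chartAt E c).symm) y := by
  rw [← contMDiffAt_iff_contDiffAt]
  exact hg.contMDiffAt.comp y ((contMDiffOn_chart_symm (x := c)).contMDiffAt
    ((chartAt E c).open_target.mem_nhds hy))

/-- A continuous function on an open set agrees near a compact subset with a locally integrable
function. -/
theorem exists_locallyIntegrable_eventuallyEq [MeasurableSpace E] [BorelSpace E] {f : E → ℝ}
    {K Ω : Set E} (hK : IsCompact K) (hΩ : IsOpen Ω) (hKΩ : K ⊆ Ω) (hf : ContinuousOn f Ω) :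
    ∃ g : E → ℝ, LocallyIntegrable g Measure.addHaar ∧ ∀ y ∈ K, f =ᶠ[𝓝 y] g := by
  have : ProperSpace E := FiniteDimensional.proper ℝ E
  obtain ⟨L, hL, hKL, hLΩ⟩ := exists_compact_between hK hΩ hKΩ
  refine ⟨L.indicator f, ?_, fun y hy => ?_⟩
  · exact (((hf.mono hLΩ).integrableOn_compact hL).integrable_indicator
      hL.measurableSet).locallyIntegrable
  · filter_upwards [mem_interior_iff_mem_nhds.1 (hKL hy)] with z hz
    exact (indicator_of_mem hz f).symm

/-- A function that is admissible over `U` can be smoothed near a compact subset of a chart by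
mollification: the property of being admissible is kept, smoothness is not lost anywhere and is
gained where the cutoff `g` is `1`, and the values change arbitrarily little. -/
theorem exists_smoothing_in_chart {U : Set N} (hU : IsOpen U) {H : CotangentBundle E N → ℝ}
    (hH : ContinuousOn H {z : CotangentBundle E N | z.1 ∈ U}) {w : N → ℝ}
    (hw : ∀ x ∈ U, ∀ c, x ∈ (chartAt E c).source → IsAdmissibleAt H c x w) {c : N} {g : N → ℝ}
    (hg : ContMDiff 𝓘(ℝ, E) 𝓘(ℝ, ℝ) ∞ g) (hg01 : ∀ x, g x ∈ Icc (0 : ℝ) 1)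
    (hgK : IsCompact (tsupport g)) (hgU : tsupport g ⊆ U)
    (hgc : tsupport g ⊆ (chartAt E c).source) {e : N → ℝ} (he : ContinuousOn e U)
    (he_pos : ∀ x ∈ U, 0 < e x) :
    ∃ w' : N → ℝ, (∀ x ∈ U, ∀ c, x ∈ (chartAt E c).source → IsAdmissibleAt H c x w') ∧
      (∀ x ∉ tsupport g, w' x = w x) ∧ (∀ x ∈ tsupport g, |w' x - w x| ≤ e x) ∧
      ∀ x ∈ U, (ContMDiffAt 𝓘(ℝ, E) 𝓘(ℝ, ℝ) ∞ w x ∨ g =ᶠ[𝓝 x] 1) →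
        ContMDiffAt 𝓘(ℝ, E) 𝓘(ℝ, ℝ) ∞ w' x := by
  borelize E
  set φ := chartAt E c with hφ
  set f := w ∘ φ.symm with hf
  set Ω := φ.target ∩ φ.symm ⁻¹' U with hΩ
  have hΩo : IsOpen Ω := φ.isOpen_inter_preimage_symm hU
  have hK : IsCompact (φ '' tsupport g) := hgK.image_of_continuousOn (φ.continuousOn.mono hgc)
  have hKΩ : φ '' tsupport g ⊆ Ω := by
    rintro _ ⟨x, hx, rfl⟩
    exact ⟨φ.map_source (hgc hx), by
      rw [mem_preimage, φ.left_inv (hgc hx)]; exact hgU hx⟩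
  have hfc : ContinuousOn f Ω := fun y hy => by
    obtain ⟨C, hC, -, -, hs⟩ := hw (φ.symm y) hy.2 c (φ.map_target hy.1)
    rw [← hφ, φ.right_inv hy.1] at hs
    exact (hs.continuousAt hC).continuousWithinAt
  obtain ⟨f', hf'i, hff'⟩ := exists_locallyIntegrable_eventuallyEq hK hΩo hKΩ hfc
  set G := g ∘ φ.symm with hG
  have hG01 : ∀ z, G z ∈ Icc (0 : ℝ) 1 := fun z => hg01 _
  have key := hK.eventually_forall_of_forall_eventually (x₀ := (0 : ℝ)) (P := fun δ z =>
    ∀ ψ : ContDiffBump (0 : E), ψ.rOut < δ →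
      (∃ C : Set (E →L[ℝ] ℝ), IsCompact C ∧ Convex ℝ C ∧
        (∀ p ∈ C, H ⟨φ.symm z, chartCovector c (φ.symm z) p⟩ < 0) ∧
        HasSlopesIn (fun y => f' y + G y * (mollify ψ f' y - f' y)) C z) ∧
      |mollify ψ f' z - f' z| ≤ e (φ.symm z)) fun y hy => by
    have hyt : y ∈ φ.target := (hKΩ hy).1
    have hyU : φ.symm y ∈ U := (hKΩ hy).2
    have hys : φ.symm y ∈ φ.source := φ.map_target hyt
    obtain ⟨C, hC, hconv, hneg, hs⟩ := hw (φ.symm y) hyU c hys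
    rw [← hφ, φ.right_inv hyt] at hs
    obtain ⟨η, hη, hev⟩ := exists_thickening_neg hU hH hyU hys hC hneg
    have hsymm : Tendsto φ.symm (𝓝 y) (𝓝 (φ.symm y)) := φ.continuousAt_symm hyt
    have he2 : ∀ᶠ z in 𝓝 y, e (φ.symm y) / 2 < e (φ.symm z) :=
      hsymm.eventually ((he.continuousAt (hU.mem_nhds hyU)).eventually_const_lt
        (half_lt_self (he_pos _ hyU)))
    have hmoll := (hs.congr (hff' y hy)).eventually_mollify hf'i hconv hC
      (G := G) ((hg.contDiffAt_comp_chart_symm hyt).of_le (by simp)) hG01 hη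
      (half_pos (he_pos _ hyU))
    filter_upwards [hmoll, continuousAt_snd.eventually (hsymm.eventually hev),
      continuousAt_snd.eventually he2] with q hq1 hq2 hq3 ψ hψ
    obtain ⟨h1, h2⟩ := hq1 ψ hψ
    exact ⟨⟨_, hC.cthickening, hconv.cthickening η, hq2, h1⟩, h2.trans hq3.le⟩
  obtain ⟨δ, hδ, hδpos⟩ :=
    ((key.filter_mono (nhdsWithin_le_nhds (s := Ioi 0))).and eventually_mem_nhdsWithin).exists
  rw [mem_Ioi] at hδpos
  let ψ : ContDiffBump (0 : E) := ⟨δ / 3, δ / 2, by positivity, by linarith⟩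
  have hψ : ψ.rOut < δ := half_lt_self hδpos
  set m := mollify ψ f' with hm
  have hmsm : ContDiff ℝ ∞ m := contDiff_mollify ψ hf'i
  have hff'x : ∀ x ∈ tsupport g, f' (φ x) = w x := fun x hx => by
    rw [← (hff' _ (mem_image_of_mem φ hx)).self_of_nhds, hf, Function.comp_apply,
      φ.left_inv (hgc hx)]
  have hoff : ∀ x ∉ tsupport g, (fun x => w x + g x * (m (φ x) - w x)) =ᶠ[𝓝 x] w := fun x hx => by
    filter_upwards [(isClosed_tsupport g).isOpen_compl.mem_nhds hx] with z hz
    simp [image_eq_zero_of_notMem_tsupport hz]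
  refine ⟨fun x => w x + g x * (m (φ x) - w x), ?_, fun x hx => (hoff x hx).self_of_nhds,
    ?_, ?_⟩
  · intro x hxU c' hxc'
    by_cases hx : x ∈ tsupport g
    · have hxc := hgc hx
      refine IsAdmissibleAt.change_chart hU hH hxU hxc hxc' ?_
      obtain ⟨⟨C, hC, hconv, hneg, hs⟩, -⟩ := hδ _ (mem_image_of_mem φ hx) ψ hψ
      rw [φ.left_inv hxc] at hneg
      refine ⟨C, hC, hconv, hneg, hs.congr ?_⟩
      filter_upwards [hff' _ (mem_image_of_mem φ hx),
        φ.open_target.mem_nhds (φ.map_source hxc)] with z hz hzt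
      rw [← hz]
      simp [hf, hG, hm, ← hφ, φ.right_inv hzt]
    · exact (hw x hxU c' hxc').congr hxc' (hoff x hx).symm
  · intro x hx
    have h := (hδ _ (mem_image_of_mem φ hx) ψ hψ).2
    rw [hff'x x hx, φ.left_inv (hgc hx)] at h
    simp only [add_sub_cancel_left, abs_mul, abs_of_nonneg (hg01 x).1]
    exact (mul_le_of_le_one_left (abs_nonneg _) (hg01 x).2).trans h
  · intro x hxU hx
    by_cases hxg : x ∈ tsupport g
    · have hmx : ContMDiffAt 𝓘(ℝ, E) 𝓘(ℝ, ℝ) ∞ (m ∘ φ) x :=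
        hmsm.contMDiff.contMDiffAt.comp x
          ((contMDiffOn_chart (x := c)).contMDiffAt (φ.open_source.mem_nhds (hgc hxg)))
      rcases hx with hx | hx
      · exact hx.add (hg.contMDiffAt.mul (hmx.sub hx))
      · refine hmx.congr_of_eventuallyEq ?_
        filter_upwards [hx] with z hz
        simp [hz]
    · rcases hx with hx | hx
      · exact hx.congr_of_eventuallyEq (hoff x hxg)
      · have := hx.self_of_nhds
        rw [image_eq_zero_of_notMem_tsupport hxg] at this
        simp at this

end Step

/-! ### Cutoff functions -/

section Cutoffs

variable {E : Type*} [NormedAddCommGroup E] [NormedSpace ℝ E] [FiniteDimensional ℝ E]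
  {N : Type*} [TopologicalSpace N] [ChartedSpace E N] [IsManifold 𝓘(ℝ, E) ∞ N]
  [T2Space N] [SecondCountableTopology N]

/-- An open subset of a manifold is covered by the interiors of the sets where a sequence of smooth
cutoff functions equals `1`; their supports are compact subsets of charts, and form a family that
is locally finite in the open subset. -/
theorem exists_seq_cutoff [Nonempty N] {U : Set N} (hU : IsOpen U) :
    ∃ (c : ℕ → N) (g : ℕ → N → ℝ), (∀ k, ContMDiff 𝓘(ℝ, E) 𝓘(ℝ, ℝ) ∞ (g k)) ∧
      (∀ k x, g k x ∈ Icc (0 : ℝ) 1) ∧ (∀ k, IsCompact (tsupport (g k))) ∧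
      (∀ k, tsupport (g k) ⊆ U) ∧ (∀ k, tsupport (g k) ⊆ (chartAt E (c k)).source) ∧
      (∀ x ∈ U, ∃ k, g k =ᶠ[𝓝 x] 1) ∧
      ∀ x ∈ U, ∃ T ∈ 𝓝 x, {k | (tsupport (g k) ∩ T).Nonempty}.Finite := by
  have : ProperSpace E := FiniteDimensional.proper ℝ E
  have : LocallyCompactSpace N := ChartedSpace.locallyCompactSpace E N
  have : LocallyCompactSpace U := hU.locallyCompactSpace
  -- Small open sets: those contained in a compact subset of `U` inside a chart.
  have hbasis : ∀ x : U, (𝓝 x).HasBasis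
      (fun S : Set U => IsOpen S ∧ x ∈ S ∧
        ∃ K, IsCompact K ∧ (↑) '' S ⊆ K ∧ K ⊆ U ∩ (chartAt E x.1).source) id := fun x => by
    refine ⟨fun T => ⟨fun hT => ?_,
      fun ⟨S, hS, hST⟩ => mem_of_superset (hS.1.mem_nhds hS.2.1) hST⟩⟩
    have hT' : (↑) '' T ∩ (chartAt E x.1).source ∈ 𝓝 x.1 :=
      inter_mem (hU.isOpenEmbedding_subtypeVal.image_mem_nhds.2 hT) (chart_source_mem_nhds E x.1)
    obtain ⟨K, hKx, hKT, hK⟩ := local_compact_nhds hT'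
    refine ⟨(↑) ⁻¹' interior K, ⟨isOpen_interior.preimage continuous_subtype_val,
      mem_interior_iff_mem_nhds.2 hKx, K, hK, ?_, fun z hz => ?_⟩, fun z hz => ?_⟩
    · exact (image_preimage_subset _ _).trans interior_subset
    · obtain ⟨⟨z', -, rfl⟩, hz2⟩ := hKT hz
      exact ⟨z'.2, hz2⟩
    · obtain ⟨⟨z', hz', hzz⟩, -⟩ := hKT (interior_subset hz)
      rwa [← Subtype.ext hzz]
  obtain ⟨α, c, S, hS, hScov, hSfin⟩ :=
    refinement_of_locallyCompact_sigmaCompact_of_nhds_basis hbasis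
  simp only [id] at hS hScov hSfin
  obtain ⟨F, hFcov, hFc, hFS⟩ := exists_iUnion_eq_closed_subset (fun a => (hS a).1)
    (fun x => hSfin.point_finite x) hScov
  have hcut : ∀ a : α, ∃ g : N → ℝ, ContMDiff 𝓘(ℝ, E) 𝓘(ℝ, ℝ) ∞ g ∧
      (∀ x, g x ∈ Icc (0 : ℝ) 1) ∧ tsupport g ⊆ (↑) '' S a ∧
      ∀ x ∈ F a, g =ᶠ[𝓝 (x : N)] 1 := fun a => by
    obtain ⟨K, hK, hSK, hKU⟩ := (hS a).2.2
    have hFcl : IsClosed ((↑) '' F a : Set N) := by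
      obtain ⟨Z, hZ, hZF⟩ := isClosed_induced_iff.1 (hFc a)
      have : ((↑) '' F a : Set N) = Z ∩ K := by
        ext x
        constructor
        · rintro ⟨x, hx, rfl⟩
          exact ⟨by rw [← hZF] at hx; exact hx, hSK (mem_image_of_mem _ (hFS a hx))⟩
        · rintro ⟨hxZ, hxK⟩
          exact ⟨⟨x, (hKU hxK).1⟩, by rw [← hZF]; exact hxZ, rfl⟩
      rw [this]
      exact hZ.inter hK.isClosed
    have hSo : IsOpen ((↑) '' S a : Set N) := hU.isOpenMap_subtype_val _ (hS a).1
    obtain ⟨g, hg0, hg1, hg01⟩ := exists_contMDiffMap_zero_one_nhds_of_isClosed 𝓘(ℝ, E) (n := ⊤)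
      hSo.isClosed_compl hFcl (disjoint_compl_left_iff_subset.2 (image_mono (hFS a)))
    refine ⟨g, g.contMDiff, hg01, fun x hx => ?_, fun x hx => ?_⟩
    · by_contra hxS
      exact (notMem_tsupport_iff_eventuallyEq.2
        (eventually_nhdsSet_iff_forall.1 hg0 x hxS)) hx
    · exact eventually_nhdsSet_iff_forall.1 hg1 x (mem_image_of_mem _ hx)
  choose g hgsm hg01 hgS hg1 using hcut
  have hcount : Countable α := by
    rw [← countable_univ_iff]
    exact hSfin.countable_univ fun a => ⟨c a, (hS a).2.1⟩
  obtain ⟨ι, hι⟩ := hcount.exists_injective_nat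
  -- The family is indexed by `ℕ` through the injection `ι`, with zero functions elsewhere.
  let c' : ℕ → N := Function.extend ι (fun a => (c a : N)) fun _ => Classical.arbitrary N
  let g' : ℕ → N → ℝ := Function.extend ι g fun _ => 0
  have hrange : ∀ P : N → (N → ℝ) → Prop, (∀ a, P (c a) (g a)) → (∀ b, P b 0) →
      ∀ k, P (c' k) (g' k) := fun P h1 h2 k => by
    by_cases hk : ∃ a, ι a = k
    · obtain ⟨a, rfl⟩ := hk
      simpa only [c', g', hι.extend_apply] using h1 a
    · simpa only [c', g', Function.extend_apply' _ _ _ hk] using h2 _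
  have h0 : tsupport (0 : N → ℝ) = ∅ := tsupport_eq_empty_iff.2 rfl
  have hgK : ∀ a, ∃ K, IsCompact K ∧ tsupport (g a) ⊆ K ∧ K ⊆ U ∩ (chartAt E (c a : N)).source :=
    fun a => by
      obtain ⟨K, hK, hSK, hKU⟩ := (hS a).2.2
      exact ⟨K, hK, (hgS a).trans hSK, hKU⟩
  refine ⟨c', g', ?_, ?_, ?_, ?_, ?_, fun x hx => ?_, fun x hx => ?_⟩
  · exact hrange (fun _ g => ContMDiff 𝓘(ℝ, E) 𝓘(ℝ, ℝ) ∞ g) hgsm fun _ => contMDiff_const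
  · exact hrange (fun _ g => ∀ x, g x ∈ Icc (0 : ℝ) 1) hg01 fun _ _ => by simp
  · refine hrange (fun _ g => IsCompact (tsupport g)) (fun a => ?_) fun _ => by simp [h0]
    obtain ⟨K, hK, hgK, -⟩ := hgK a
    exact hK.of_isClosed_subset (isClosed_tsupport _) hgK
  · refine hrange (fun _ g => tsupport g ⊆ U) (fun a => ?_) fun _ => by simp [h0]
    obtain ⟨K, -, hgK, hKU⟩ := hgK a
    exact fun x hx => (hKU (hgK hx)).1
  · refine hrange (fun c g => tsupport g ⊆ (chartAt E c).source) (fun a => ?_) fun _ => by simp [h0]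
    obtain ⟨K, -, hgK, hKU⟩ := hgK a
    exact fun x hx => (hKU (hgK hx)).2
  · obtain ⟨a, ha⟩ := mem_iUnion.1 (hFcov ▸ mem_univ (⟨x, hx⟩ : U))
    exact ⟨ι a, by simpa only [g', hι.extend_apply] using hg1 a _ ha⟩
  · obtain ⟨T, hT, hTfin⟩ := hSfin ⟨x, hx⟩
    refine ⟨(↑) '' T, hU.isOpenEmbedding_subtypeVal.image_mem_nhds.2 hT,
      (hTfin.image ι).subset ?_⟩
    rintro k ⟨z, hzk, z, hz, rfl⟩
    by_cases hk : ∃ a, ι a = k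
    · obtain ⟨a, rfl⟩ := hk
      simp only [g', hι.extend_apply] at hzk
      obtain ⟨z', hz', hzz⟩ := hgS a hzk
      rw [Subtype.ext hzz] at hz'
      exact ⟨a, ⟨z, hz', hz⟩, rfl⟩
    · simp only [g', Function.extend_apply' _ _ _ hk, h0] at hzk
      exact hzk.elim

end Cutoffs

/-! ### Locally finite smoothing and behaviour on the boundary -/

section Gluing

variable {E : Type*} [NormedAddCommGroup E] [NormedSpace ℝ E]
  {N : Type*} [TopologicalSpace N] [ChartedSpace E N] [IsManifold 𝓘(ℝ, E) ∞ N]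

omit [IsManifold 𝓘(ℝ, E) ∞ N] in
theorem IsLocallyLipschitz.continuous {u : N → ℝ} (hu : IsLocallyLipschitz E u) :
    Continuous u := by
  refine continuous_iff_continuousAt.2 fun x => ?_
  obtain ⟨K, s, hs, hK⟩ := hu x
  have h := (hK.continuousOn.continuousAt hs).comp
    ((chartAt E x).continuousAt (mem_chart_source E x))
  exact h.congr (eventuallyEq_comp_chart u (mem_chart_source E x)).symm

/-- A perturbation dominated by a smooth function vanishes to first order wherever that function
vanishes, because zeros of a nonnegative function are minima. -/
theorem hasFDerivAt_chart_zero_of_abs_le {h f : N → ℝ} (hf : ContMDiff 𝓘(ℝ, E) 𝓘(ℝ, ℝ) ∞ f)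
    (hhf : ∀ z, |h z| ≤ f z) {x : N} (hx : f x = 0) :
    HasFDerivAt (h ∘ (chartAt E x).symm) (0 : E →L[ℝ] ℝ) (chartAt E x x) := by
  have hxs := mem_chart_source E x
  have hl : (chartAt E x).symm (chartAt E x x) = x := (chartAt E x).left_inv hxs
  have hd : DifferentiableAt ℝ (f ∘ (chartAt E x).symm) (chartAt E x x) :=
    (isDiffAt_iff_chart hxs).1 (hf.contMDiffAt.mdifferentiableAt (by simp))
  have hmin : IsLocalMin (f ∘ (chartAt E x).symm) (chartAt E x x) :=
    Eventually.of_forall fun z => by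
      simp only [Function.comp_apply, hl, hx]
      exact (abs_nonneg _).trans (hhf _)
  have hfd := hd.hasFDerivAt
  rw [hmin.fderiv_eq_zero, hasFDerivAt_iff_isLittleO] at hfd
  have hh : h x = 0 := abs_nonpos_iff.1 (hx ▸ hhf x)
  rw [hasFDerivAt_iff_isLittleO]
  refine Asymptotics.IsBigO.trans_isLittleO (Asymptotics.IsBigO.of_bound 1
    (Eventually.of_forall fun z => ?_)) hfd
  simp only [Function.comp_apply, hl, hx, hh, zero_apply, sub_zero, one_mul,
    Real.norm_eq_abs]
  exact (hhf _).trans (le_abs_self _)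

/-- Perturbing by a function dominated by a smooth function does not affect differentials at the
zeros of the latter. -/
theorem differential_eq_of_abs_sub_le {u v f : N → ℝ} (hf : ContMDiff 𝓘(ℝ, E) 𝓘(ℝ, ℝ) ∞ f)
    (huv : ∀ z, |u z - v z| ≤ f z) {x : N} (hx : f x = 0) (hu : IsDiffAt E u x) :
    IsDiffAt E v x ∧ differential E v x = differential E u x := by
  have hxs := mem_chart_source E x
  have h0 := hasFDerivAt_chart_zero_of_abs_le (h := fun z => u z - v z) hf huv hx
  have hu' := ((isDiffAt_iff_chart hxs).1 hu).hasFDerivAt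
  have hv' := (hu'.sub h0).congr_of_eventuallyEq
    (f₁ := v ∘ (chartAt E x).symm) (Eventually.of_forall fun z => by simp)
  have hv : IsDiffAt E v x := (isDiffAt_iff_chart hxs).2 hv'.differentiableAt
  refine ⟨hv, ?_⟩
  rw [differential_eq_chartCovector hxs hv, differential_eq_chartCovector hxs hu, hv'.fderiv,
    sub_zero]

variable [FiniteDimensional ℝ E] [T2Space N] [SecondCountableTopology N]

/-- Admissible functions over `U` are approximated by functions that are smooth and admissible
over `U`: the smoothings in charts are performed one after the other, and near each point of `U`
only finitely many of them have an effect. -/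
theorem exists_smooth_admissible [Nonempty N] {U : Set N} (hU : IsOpen U)
    {H : CotangentBundle E N → ℝ}
    (hH : ContinuousOn H {z : CotangentBundle E N | z.1 ∈ U}) {u : N → ℝ}
    (hu : ∀ x ∈ U, ∀ c, x ∈ (chartAt E c).source → IsAdmissibleAt H c x u) {e : N → ℝ}
    (he : ContinuousOn e U) (he_pos : ∀ x ∈ U, 0 < e x) :
    ∃ v : N → ℝ, (∀ x ∈ U, ContMDiffAt 𝓘(ℝ, E) 𝓘(ℝ, ℝ) ∞ v x) ∧
      (∀ x ∈ U, IsAdmissibleAt H x x v) ∧ (∀ x ∈ U, |u x - v x| ≤ e x) ∧ ∀ x ∉ U, v x = u x := by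
  obtain ⟨c, g, hg, hg01, hgK, hgU, hgc, hgcov, hgfin⟩ := exists_seq_cutoff (E := E) hU
  -- The steps change the values by at most `e / 2`, `e / 4`, `e / 8`, ...
  choose F hFadm hFoff hFle hFsm using fun (k : ℕ)
    (w : {w : N → ℝ // ∀ x ∈ U, ∀ c, x ∈ (chartAt E c).source → IsAdmissibleAt H c x w}) =>
      exists_smoothing_in_chart hU hH w.2 (hg k) (hg01 k) (hgK k) (hgU k) (hgc k)
        (e := fun x => (1 / 2 : ℝ) ^ (k + 1) * e x) (continuousOn_const.mul he)
        (fun x hx => mul_pos (by positivity) (he_pos x hx))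
  let W : ℕ → {w : N → ℝ // ∀ x ∈ U, ∀ c, x ∈ (chartAt E c).source → IsAdmissibleAt H c x w} :=
    fun k => Nat.rec ⟨u, hu⟩ (fun k w => ⟨F k w, hFadm k w⟩) k
  have hW0 : (W 0).1 = u := rfl
  have hWsucc : ∀ k, (W (k + 1)).1 = F k (W k) := fun k => rfl
  have hWoff : ∀ k, ∀ x ∉ U, (W k).1 x = u x := fun k => by
    induction k with
    | zero => exact fun x _ => rfl
    | succ k ih =>
      intro x hx
      rw [hWsucc, hFoff k (W k) x fun h => hx (hgU k h), ih x hx]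
  have hWle : ∀ k, ∀ x ∈ U, |u x - (W k).1 x| ≤ (1 - (1 / 2 : ℝ) ^ k) * e x := fun k => by
    induction k with
    | zero => intro x _; simp [hW0]
    | succ k ih =>
      intro x hx
      have hstep : |(W k).1 x - (W (k + 1)).1 x| ≤ (1 / 2 : ℝ) ^ (k + 1) * e x := by
        rw [hWsucc, abs_sub_comm]
        by_cases hxg : x ∈ tsupport (g k)
        · exact hFle k (W k) x hxg
        · rw [hFoff k (W k) x hxg, sub_self, abs_zero]
          exact mul_nonneg (by positivity) (he_pos x hx).le
      calc |u x - (W (k + 1)).1 x|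
          ≤ |u x - (W k).1 x| + |(W k).1 x - (W (k + 1)).1 x| := abs_sub_le _ _ _
        _ ≤ (1 - (1 / 2 : ℝ) ^ k) * e x + (1 / 2 : ℝ) ^ (k + 1) * e x := add_le_add (ih x hx) hstep
        _ = _ := by ring
  have hstab : ∀ x : N, ∃ n, x ∈ U → ∃ T ∈ 𝓝 x, ∀ k ≥ n, ∀ y ∈ T, (W k).1 y = (W n).1 y := by
    intro x
    by_cases hx : x ∈ U
    swap
    · exact ⟨0, fun h => absurd h hx⟩
    obtain ⟨T, hT, hfin⟩ := hgfin x hx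
    obtain ⟨n, hn⟩ := hfin.bddAbove
    refine ⟨n + 1, fun _ => ⟨T, hT, fun k hk => ?_⟩⟩
    induction k, hk using Nat.le_induction with
    | base => exact fun _ _ => rfl
    | succ k hk ih =>
      intro y hy
      rw [← ih y hy, hWsucc]
      refine hFoff k (W k) y fun hyg => ?_
      have := hn (show k ∈ {k | (tsupport (g k) ∩ T).Nonempty} from ⟨y, hyg, hy⟩)
      omega
  choose n hn using hstab
  have hloc : ∀ x ∈ U, ∀ k ≥ n x, (W k).1 =ᶠ[𝓝 x] fun y => (W (n y)).1 y := fun x hx k hk => by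
    obtain ⟨T, hT, hTn⟩ := hn x hx
    filter_upwards [hT, hU.mem_nhds hx] with y hyT hyU
    obtain ⟨T', hT', hTn'⟩ := hn y hyU
    rw [hTn k hk y hyT, ← hTn (max (n x) (n y)) (le_max_left _ _) y hyT,
      hTn' (max (n x) (n y)) (le_max_right _ _) y (mem_of_mem_nhds hT')]
  -- Near `x`, the limit coincides with every `W k` for `k ≥ n x`.
  refine ⟨fun y => (W (n y)).1 y, fun x hx => ?_, fun x hx => ?_, fun x hx => ?_,
    fun x hx => hWoff _ x hx⟩
  · obtain ⟨j, hj⟩ := hgcov x hx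
    have hsm : ∀ k ≥ j + 1, ContMDiffAt 𝓘(ℝ, E) 𝓘(ℝ, ℝ) ∞ (W k).1 x := fun k hk => by
      induction k, hk using Nat.le_induction with
      | base => exact hFsm j (W j) x hx (Or.inr hj)
      | succ k hk ih => exact hFsm k (W k) x hx (Or.inl ih)
    exact (hsm (max (j + 1) (n x)) (le_max_left _ _)).congr_of_eventuallyEq
      (hloc x hx _ (le_max_right _ _)).symm
  · exact ((W (n x)).2 x hx x (mem_chart_source E x)).congr (mem_chart_source E x)
      (hloc x hx _ le_rfl)
  · refine (hWle (n x) x hx).trans (mul_le_of_le_one_left (he_pos x hx).le ?_)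
    have : (0 : ℝ) ≤ (1 / 2 : ℝ) ^ n x := by positivity
    linarith

end Gluing

/-! ### The approximation theorem -/

theorem mainTheorem3
    {E : Type*} [NormedAddCommGroup E] [NormedSpace ℝ E] [FiniteDimensional ℝ E]
    {N : Type*} [TopologicalSpace N] [ChartedSpace E N] [IsManifold 𝓘(ℝ, E) ∞ N]
    [T2Space N] [SecondCountableTopology N]
    (u : N → ℝ) (hu : IsLocallyLipschitz E u)
    (U : Set N) (hU : IsOpen U)
    (H : CotangentBundle E N → ℝ)
    (hH : ContinuousOn H {z : CotangentBundle E N | z.1 ∈ U})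
    (hneg : ∀ z ∈ clarkeGraph E u, z.1 ∈ U → H z < 0)
    (ε : N → ℝ) (hε : ContinuousOn ε U) (hε_pos : ∀ x ∈ U, 0 < ε x) :
    ∃ v : N → ℝ, Continuous v ∧
      ContMDiffOn 𝓘(ℝ, E) 𝓘(ℝ, ℝ) ∞ v U ∧
      (∀ x ∈ U, H ⟨x, differential E v x⟩ < 0) ∧
      (∀ x ∈ U, |u x - v x| ≤ ε x) ∧
      ∀ x ∉ U, v x = u x ∧ (IsDiffAt E v x ↔ IsDiffAt E u x) ∧
        (IsDiffAt E u x → differential E v x = differential E u x) := by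
  rcases isEmpty_or_nonempty N with hN | hN
  · exact ⟨u, hu.continuous, fun x => isEmptyElim x, fun x => isEmptyElim x,
      fun x => isEmptyElim x, fun x => isEmptyElim x⟩
  have : ProperSpace E := FiniteDimensional.proper ℝ E
  have : LocallyCompactSpace N := ChartedSpace.locallyCompactSpace E N
  -- The smooth function `f` controls the approximation at the boundary of `U`.
  obtain ⟨f, hfU, hf, hf0⟩ := hU.exists_contMDiff_support_eq 𝓘(ℝ, E) (n := ⊤)
  have hfpos : ∀ x ∈ U, 0 < f x := fun x hx =>
    (hf0 x).lt_of_ne' (Function.mem_support.1 (hfU ▸ hx))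
  have hfzero : ∀ x ∉ U, f x = 0 := fun x hx => Function.notMem_support.1 (hfU ▸ hx)
  obtain ⟨v, hvsm, hvadm, hvle, hvoff⟩ := exists_smooth_admissible (E := E) hU hH (u := u)
    (fun x hx c hxc => (isAdmissibleAt_of_clarke_neg hu hU hH hx fun p hp =>
      hneg ⟨x, p⟩ hp hx).change_chart hU hH hx (mem_chart_source E x) hxc)
    (e := fun x => min (ε x) (f x)) (hε.inf hf.continuous.continuousOn)
    (fun x hx => lt_min (hε_pos x hx) (hfpos x hx))
  have huv : ∀ x, |u x - v x| ≤ f x := fun x => by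
    by_cases hx : x ∈ U
    · exact (hvle x hx).trans (min_le_right _ _)
    · rw [hvoff x hx, sub_self, abs_zero]
      exact hf0 x
  have hvu : ∀ x, |v x - u x| ≤ f x := fun x => abs_sub_comm (u x) (v x) ▸ huv x
  refine ⟨v, ?_, fun x hx => (hvsm x hx).contMDiffWithinAt, fun x hx => ?_,
    fun x hx => (hvle x hx).trans (min_le_left _ _), fun x hx => ⟨hvoff x hx, ?_, ?_⟩⟩
  · refine continuous_iff_continuousAt.2 fun x => ?_
    by_cases hx : x ∈ U
    · exact (hvsm x hx).continuousAt
    · have hlim : Tendsto (fun z => v z - u z) (𝓝 x) (𝓝 0) :=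
        squeeze_zero_norm hvu (by simpa [hfzero x hx] using hf.continuous.tendsto x)
      have := hlim.add (hu.continuous.tendsto x)
      rw [ContinuousAt, hvoff x hx]
      simpa using this
  · exact (hvadm x hx).differential_neg (mem_chart_source E x)
      ((hvsm x hx).mdifferentiableAt (by simp))
  · exact ⟨fun h => (differential_eq_of_abs_sub_le hf hvu (hfzero x hx) h).1,
      fun h => (differential_eq_of_abs_sub_le hf huv (hfzero x hx) h).1⟩
  · exact fun h => (differential_eq_of_abs_sub_le hf huv (hfzero x hx) h).2
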